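/- Let $G$ be a (discrete) group. Regard $\ell^1(G)$ as a complex Banach algebra under the convolution product $(a\star b)(s)=\sum_{t\in G}a(t)\,b(t^{-1}s)$ and, for $1\le r<\infty$, regard $\ell^r(G)$ as a Banach left $\ell^1(G)$-module under $(a\star x)(s)=\sum_{t\in G}a(t)\,x(t^{-1}s)$ $(a\in\ell^1(G),\ x\in\ell^r(G),\ s\in G)$. A Banach left module $J$ over a Banach algebra $A$ is called injective if, for all Banach left $A$-modules $E,F$, every injective bounded $A$-module morphism $T:E\to F$ that has a bounded linear left inverse, and every bounded $A$-module morphism $S:E\to J$, there is a bounded $A$-module morphism $R:F\to J$ with $R\circ T=S$. Let $1<p<\infty$. If $\ell^p(G)$ is an injective Banach left $\ell^1(G)$-module, then $\ell^q(G)$ is an injective Banach left $\ell^1(G)$-module for every $q$ with $p\le q<\infty$. -/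

import Mathlib

open scoped ENNReal

universe u v w

noncomputable section

/-! ### Banach left modules over a Banach algebra and injectivity -/

/-- The structure of a Banach left `A`-module on a Banach space `E`, for a complex Banach algebra
`A`: a bounded bilinear map
`(a, x) ↦ a · x` from `A × E` to `E` with `(a b) · x = a · (b · x)`. Neither `A` nor the action is
required to be unital. -/
structure BanachLeftModule (A : Type u) [NonUnitalNormedRing A] [NormedSpace ℂ A]
    [IsScalarTower ℂ A A] [SMulCommClass ℂ A A] [CompleteSpace A]
    (E : Type v) [NormedAddCommGroup E] [NormedSpace ℂ E] [CompleteSpace E] where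
  /-- the module operation -/
  act : A →L[ℂ] E →L[ℂ] E
  mul_act : ∀ (a b : A) (x : E), act (a * b) x = act a (act b x)

namespace BanachLeftModule

/-- A bounded operator `T : E → F` is a morphism of left `A`-modules if `T (a · x) = a · T x`. -/
def IsMorphism {A : Type u} [NonUnitalNormedRing A] [NormedSpace ℂ A]
    [IsScalarTower ℂ A A] [SMulCommClass ℂ A A] [CompleteSpace A]
    {E : Type v} [NormedAddCommGroup E] [NormedSpace ℂ E] [CompleteSpace E]
    {F : Type w} [NormedAddCommGroup F] [NormedSpace ℂ F] [CompleteSpace F]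
    (mE : BanachLeftModule A E) (mF : BanachLeftModule A F) (T : E →L[ℂ] F) : Prop :=
  ∀ (a : A) (x : E), T (mE.act a x) = mF.act a (T x)

/-- An injective bounded operator `T : E → F` is admissible if it has a bounded linear left
inverse. -/
def IsAdmissibleMono {E : Type v} [NormedAddCommGroup E] [NormedSpace ℂ E]
    {F : Type w} [NormedAddCommGroup F] [NormedSpace ℂ F] (T : E →L[ℂ] F) : Prop :=
  Function.Injective T ∧ ∃ S : F →L[ℂ] E, S.comp T = ContinuousLinearMap.id ℂ E

/-- Injectivity of the Banach left `A`-module `J`: for all Banach left `A`-modules `E` and `F`,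
every morphism `E → J` extends along every admissible monomorphism of modules `E → F` to a
morphism `F → J`. -/
def IsInjective {A J : Type u} [NonUnitalNormedRing A] [NormedSpace ℂ A]
    [IsScalarTower ℂ A A] [SMulCommClass ℂ A A] [CompleteSpace A]
    [NormedAddCommGroup J] [NormedSpace ℂ J] [CompleteSpace J] (mJ : BanachLeftModule A J) : Prop :=
  ∀ (E F : Type u) [NormedAddCommGroup E] [NormedSpace ℂ E] [CompleteSpace E]
    [NormedAddCommGroup F] [NormedSpace ℂ F] [CompleteSpace F]
    (mE : BanachLeftModule A E) (mF : BanachLeftModule A F) (T : E →L[ℂ] F) (S : E →L[ℂ] J),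
    IsMorphism mE mF T → IsAdmissibleMono T → IsMorphism mE mJ S →
      ∃ R : F →L[ℂ] J, IsMorphism mF mJ R ∧ R.comp T = S

end BanachLeftModule

/-! ### The spaces `ℓ^p(G)` and the convolution action of `ℓ¹(G)` -/

/-- The complex Banach space `ℓ^p(G)`. -/
abbrev Ell (G : Type u) (p : ℝ≥0∞) : Type u := lp (fun _ : G => ℂ) p

namespace Ell

section

variable {G : Type u} {p : ℝ≥0∞} [Fact (1 ≤ p)]

theorem summable_norm_one (a : Ell G 1) : Summable fun t => ‖a t‖ := by
  simpa using (lp.memℓp a).summable (by simp)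

theorem norm_one_eq (a : Ell G 1) : ‖a‖ = ∑' t, ‖a t‖ := by
  simpa using lp.norm_eq_tsum_rpow (p := 1) (by simp) a

theorem memℓp_comp_equiv (e : G ≃ G) (x : Ell G p) : Memℓp (fun s => x (e s)) p := by
  have hx := lp.memℓp x
  rcases p.trichotomy with rfl | rfl | hp
  · exact absurd (Fact.out : (1 : ℝ≥0∞) ≤ 0) (by simp)
  · rw [memℓp_infty_iff] at hx ⊢
    exact hx.mono (Set.range_comp_subset_range e fun s => ‖x s‖)
  · rw [memℓp_gen_iff hp] at hx ⊢
    exact e.summable_iff.2 hx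

end

variable {G : Type u} [Group G] {p : ℝ≥0∞} [Fact (1 ≤ p)]

/-- Left translation on `ℓ^p(G)`, `(t · x)(s) = x (t⁻¹ s)`. -/
def translate (t : G) (x : Ell G p) : Ell G p :=
  ⟨fun s => x (t⁻¹ * s), memℓp_comp_equiv (Equiv.mulLeft t⁻¹) x⟩

theorem translate_apply (t : G) (x : Ell G p) (s : G) : translate t x s = x (t⁻¹ * s) := rfl

theorem norm_translate (t : G) (x : Ell G p) : ‖translate t x‖ = ‖x‖ := by
  rcases p.trichotomy with rfl | rfl | hp
  · exact absurd (Fact.out : (1 : ℝ≥0∞) ≤ 0) (by simp)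
  · rw [lp.norm_eq_ciSup, lp.norm_eq_ciSup]
    exact (Equiv.mulLeft t⁻¹).iSup_comp (g := fun s => ‖x s‖)
  · rw [lp.norm_eq_tsum_rpow hp, lp.norm_eq_tsum_rpow hp]
    congr 1
    exact (Equiv.mulLeft t⁻¹).tsum_eq fun s => ‖x s‖ ^ p.toReal

theorem translate_add (t : G) (x y : Ell G p) :
    translate t (x + y) = translate t x + translate t y := rfl

theorem translate_smul (t : G) (c : ℂ) (x : Ell G p) :
    translate t (c • x) = c • translate t x := rfl

theorem summable_smul_translate (a : Ell G 1) (x : Ell G p) :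
    Summable fun t => a t • translate t x := by
  apply Summable.of_norm
  simpa [norm_smul, norm_translate] using (summable_norm_one a).mul_right ‖x‖

theorem tsum_smul_translate_apply (a : Ell G 1) (x : Ell G p) (s : G) :
    (∑' t, a t • translate t x : Ell G p) s = ∑' t, a t * x (t⁻¹ * s) :=
  (lp.evalCLM ℂ (fun _ : G => ℂ) p s).map_tsum (summable_smul_translate a x)

theorem memℓp_conv (a : Ell G 1) (x : Ell G p) :
    Memℓp (fun s => ∑' t, a t * x (t⁻¹ * s)) p := by
  have h := lp.memℓp (∑' t, a t • translate t x : Ell G p)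
  rwa [show ((∑' t, a t • translate t x : Ell G p) : G → ℂ) = fun s => ∑' t, a t * x (t⁻¹ * s)
    from funext (tsum_smul_translate_apply a x)] at h

/-- The convolution `a ⋆ x` of `a ∈ ℓ¹(G)` and `x ∈ ℓ^p(G)`,
`(a ⋆ x)(s) = ∑_{t ∈ G} a(t) x(t⁻¹ s)`. -/
def conv (a : Ell G 1) (x : Ell G p) : Ell G p :=
  ⟨fun s => ∑' t, a t * x (t⁻¹ * s), memℓp_conv a x⟩

theorem conv_apply (a : Ell G 1) (x : Ell G p) (s : G) :
    conv a x s = ∑' t, a t * x (t⁻¹ * s) := rfl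

theorem conv_eq_tsum (a : Ell G 1) (x : Ell G p) : conv a x = ∑' t, a t • translate t x :=
  lp.ext (funext fun s => (tsum_smul_translate_apply a x s).symm)

theorem norm_conv_le (a : Ell G 1) (x : Ell G p) : ‖conv a x‖ ≤ ‖a‖ * ‖x‖ := by
  have h : ∀ t, ‖a t • translate t x‖ = ‖a t‖ * ‖x‖ := fun t => by
    rw [norm_smul, norm_translate]
  rw [conv_eq_tsum, norm_one_eq, ← tsum_mul_right]
  refine (norm_tsum_le_tsum_norm ?_).trans_eq (tsum_congr h)
  simpa only [h] using (summable_norm_one a).mul_right ‖x‖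

theorem add_conv (a b : Ell G 1) (x : Ell G p) : conv (a + b) x = conv a x + conv b x := by
  simp only [conv_eq_tsum, lp.coeFn_add, Pi.add_apply, add_smul]
  exact (summable_smul_translate a x).tsum_add (summable_smul_translate b x)

theorem conv_add (a : Ell G 1) (x y : Ell G p) : conv a (x + y) = conv a x + conv a y := by
  simp only [conv_eq_tsum, translate_add, smul_add]
  exact (summable_smul_translate a x).tsum_add (summable_smul_translate a y)

theorem smul_conv (c : ℂ) (a : Ell G 1) (x : Ell G p) : conv (c • a) x = c • conv a x := by
  simp only [conv_eq_tsum, lp.coeFn_smul, Pi.smul_apply, smul_assoc]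
  exact (summable_smul_translate a x).tsum_const_smul c

theorem conv_smul (c : ℂ) (a : Ell G 1) (x : Ell G p) : conv a (c • x) = c • conv a x := by
  simp only [conv_eq_tsum, translate_smul, smul_comm _ c]
  exact (summable_smul_translate a x).tsum_const_smul c

/-- Convolution as a bounded bilinear map `ℓ¹(G) × ℓ^p(G) → ℓ^p(G)`. -/
def convCLM (G : Type u) [Group G] (p : ℝ≥0∞) [Fact (1 ≤ p)] :
    Ell G 1 →L[ℂ] Ell G p →L[ℂ] Ell G p :=
  LinearMap.mkContinuous₂ (LinearMap.mk₂ ℂ conv add_conv smul_conv conv_add conv_smul) 1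
    fun a x => by simpa using norm_conv_le a x

theorem convCLM_apply (a : Ell G 1) (x : Ell G p) : convCLM G p a x = conv a x := rfl

theorem conv_conv (a b : Ell G 1) (x : Ell G p) : conv (conv a b) x = conv a (conv b x) := by
  classical
  have hT : ∀ (t : G) (b : Ell G 1), translate t (conv b x) = conv (translate t b) x := by
    intro t b
    refine lp.ext (funext fun s => ?_)
    rw [translate_apply, conv_apply, conv_apply, ← (Equiv.mulLeft t⁻¹).tsum_eq]
    refine tsum_congr fun r => ?_
    simp [translate_apply, mul_assoc]
  have h : conv (conv a b) x = ∑' t, conv (a t • translate t b) x := by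
    rw [conv_eq_tsum a b]
    exact ((convCLM G p).flip x).map_tsum (summable_smul_translate a b)
  rw [h, conv_eq_tsum a]
  exact tsum_congr fun t => by rw [smul_conv, hT]

/-- The Banach algebra `ℓ¹(G)`, with convolution as its product. -/
instance instNonUnitalNormedRing : NonUnitalNormedRing (Ell G 1) :=
  { (inferInstance : NormedAddCommGroup (Ell G 1)) with
    mul := fun a b => conv (p := 1) a b
    left_distrib := fun a b c => conv_add (p := 1) a b c
    right_distrib := fun a b c => add_conv (p := 1) a b c
    zero_mul := fun x => by
      change conv (p := 1) (0 : Ell G 1) x = 0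
      simpa using smul_conv (p := 1) (0 : ℂ) 0 x
    mul_zero := fun a => by
      change conv (p := 1) a (0 : Ell G 1) = 0
      simpa using conv_smul (p := 1) (0 : ℂ) a 0
    mul_assoc := fun a b c => conv_conv (p := 1) a b c
    norm_mul_le := fun a b => norm_conv_le (p := 1) a b }

instance instIsScalarTower : IsScalarTower ℂ (Ell G 1) (Ell G 1) :=
  ⟨fun c a b => smul_conv (p := 1) c a b⟩

instance instSMulCommClass : SMulCommClass ℂ (Ell G 1) (Ell G 1) :=
  ⟨fun c a b => (conv_smul (p := 1) c a b).symm⟩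

theorem mul_apply (a b : Ell G 1) (s : G) : (a * b) s = ∑' t, a t * b (t⁻¹ * s) := rfl

/-- `ℓ^p(G)` as a Banach left `ℓ¹(G)`-module, with convolution as the module operation. -/
def banachModule (G : Type u) [Group G] (p : ℝ≥0∞) [Fact (1 ≤ p)] :
    BanachLeftModule (Ell G 1) (Ell G p) where
  act := convCLM G p
  mul_act := conv_conv

end Ell

end

/-!
For a module `J` over which some `e ∈ A` acts as the identity, injectivity is the existence of a
module retraction of the orbit embedding `x ↦ (a ↦ a · x)` of `J` into the bounded operators
`A → J`. For `J = ℓ^p(G)` such a retraction `R` gives a functional on `ℓ^∞(G)`, by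
`m g = R (diag g) 1`; conversely `m` gives a retraction by averaging the generalized diagonals
`t ↦ T (δ_{t u⁻¹}) t` of an operator `T : ℓ¹(G) → ℓ^p(G)`. The only constraint on `m`, besides
`m 1 = 1`, is that these averages form a vector of `ℓ^p(G)`, which is an upper `p`-estimate for
`m`; it is extracted from `R` by averaging over random signs. The
estimate passes from `p` to every `q ≥ p` because `m f` changes by at most a factor `2` when the
values of `f` that are small compared with `‖m f‖` are replaced by `0`, and on the remaining values
`‖f t‖ ^ p` is controlled by `‖f t‖ ^ q`.
-/

noncomputable section

section SignAveraging

variable {E : Type*} [NormedAddCommGroup E] [NormedSpace ℝ E] {p : ℝ}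

theorem two_mul_norm_rpow_le_norm_add_rpow_add_norm_sub_rpow (hp : 1 ≤ p) (x y : E) :
    2 * ‖x‖ ^ p ≤ ‖x + y‖ ^ p + ‖x - y‖ ^ p := by
  have hnorm : ‖x‖ ≤ (1 / 2 : ℝ) * ‖x + y‖ + (1 / 2 : ℝ) * ‖x - y‖ := by
    have hx : (2 : ℝ) • x = (x + y) + (x - y) := by rw [two_smul]; abel
    have h := norm_add_le (x + y) (x - y)
    rw [← hx, norm_smul, Real.norm_two] at h
    linarith
  have hconv := (convexOn_rpow hp).2 (norm_nonneg (x + y)) (norm_nonneg (x - y))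
    (by norm_num : (0 : ℝ) ≤ 1 / 2) (by norm_num : (0 : ℝ) ≤ 1 / 2) (by norm_num)
  simp only [smul_eq_mul] at hconv
  have hmono := Real.rpow_le_rpow (norm_nonneg x) hnorm (zero_le_one.trans hp)
  linarith

theorem sum_norm_diag_rpow_le_of_forall_signs {ι : Type*} (hp : 1 ≤ p) (U : Finset ι)
    (a : ι → ι → E) {K : ℝ}
    (h : ∀ ε : ι → ℤˣ, ∑ v ∈ U, ‖∑ u ∈ U, ε u • a u v‖ ^ p ≤ K) :
    ∑ v ∈ U, ‖a v v‖ ^ p ≤ K := by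
  classical
  induction U using Finset.induction_on generalizing K with
  | empty => simpa using h 1
  | insert w U hw ih =>
    rw [Finset.sum_insert hw, ← le_sub_iff_add_le']
    refine ih fun ε => ?_
    -- Average the hypothesis over the two choices of the sign at `w`.
    let rest (v : ι) : E := ∑ u ∈ U, ε u • a u v
    have hsum (σ : ℤˣ) (v : ι) :
        ∑ u ∈ insert w U, Function.update ε w σ u • a u v = rest v + σ • a w v := by
      rw [Finset.sum_insert hw, Function.update_self, add_comm]
      congr 1
      refine Finset.sum_congr rfl fun u hu => ?_
      rw [Function.update_of_ne (ne_of_mem_of_not_mem hu hw)]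
    have hadd := h (Function.update ε w 1)
    have hsub := h (Function.update ε w (-1))
    simp only [hsum, one_smul, Units.neg_smul, ← sub_eq_add_neg, Finset.sum_insert hw]
      at hadd hsub
    have hdiag := two_mul_norm_rpow_le_norm_add_rpow_add_norm_sub_rpow hp (a w w) (rest w)
    rw [add_comm (a w w), norm_sub_rev] at hdiag
    have hrest := Finset.sum_le_sum fun v (_ : v ∈ U) =>
      two_mul_norm_rpow_le_norm_add_rpow_add_norm_sub_rpow hp (rest v) (a w v)
    rw [← Finset.mul_sum, Finset.sum_add_distrib] at hrest
    linarith

end SignAveraging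

section Truncation

variable {ι : Type*} {E : ι → Type*} [∀ i, NormedAddCommGroup (E i)]

open scoped Classical in
/-- The part of a bounded family above the level `l`: entries of norm at most `l` are replaced by
`0`. -/
def lpTruncation (l : ℝ) (f : lp E ∞) : lp E ∞ :=
  ⟨fun i => if ‖f i‖ ≤ l then 0 else f i, memℓp_infty ⟨‖f‖, by
    rintro _ ⟨i, rfl⟩
    dsimp only
    split_ifs
    · simp only [norm_zero, norm_nonneg]
    · exact lp.norm_apply_le_norm ENNReal.top_ne_zero f i⟩⟩

theorem lpTruncation_of_le {l : ℝ} {f : lp E ∞} {i : ι} (h : ‖f i‖ ≤ l) :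
    lpTruncation l f i = 0 :=
  if_pos h

theorem lpTruncation_of_lt {l : ℝ} {f : lp E ∞} {i : ι} (h : l < ‖f i‖) :
    lpTruncation l f i = f i :=
  if_neg h.not_ge

theorem norm_sub_lpTruncation_le {l : ℝ} (hl : 0 ≤ l) (f : lp E ∞) :
    ‖f - lpTruncation l f‖ ≤ l := by
  refine lp.norm_le_of_forall_le hl fun i => ?_
  rw [lp.coeFn_sub, Pi.sub_apply]
  rcases le_or_gt ‖f i‖ l with h | h
  · rwa [lpTruncation_of_le h, sub_zero]
  · rwa [lpTruncation_of_lt h, sub_self, norm_zero]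

theorem rpow_mul_norm_lpTruncation_rpow_le {l p q : ℝ} (hl : 0 ≤ l) (hp : 0 < p) (hpq : p ≤ q)
    (f : lp E ∞) (i : ι) : l ^ (q - p) * ‖lpTruncation l f i‖ ^ p ≤ ‖f i‖ ^ q := by
  rcases le_or_gt ‖f i‖ l with h | h
  · rw [lpTruncation_of_le h, norm_zero, Real.zero_rpow hp.ne', mul_zero]
    positivity
  · rw [lpTruncation_of_lt h]
    calc l ^ (q - p) * ‖f i‖ ^ p ≤ ‖f i‖ ^ (q - p) * ‖f i‖ ^ p := by gcongr
      _ = ‖f i‖ ^ q := by rw [← Real.rpow_add (hl.trans_lt h), sub_add_cancel]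

variable {𝕜 : Type*} [RCLike 𝕜] [∀ i, NormedSpace 𝕜 (E i)]
  {F : Type*} [NormedAddCommGroup F] [NormedSpace 𝕜 F]

theorem norm_half_le_norm_apply_lpTruncation (m : lp E ∞ →L[𝕜] F) (f : lp E ∞) :
    ‖m f‖ / 2 ≤ ‖m (lpTruncation (‖m f‖ / (2 * ‖m‖)) f)‖ := by
  set l := ‖m f‖ / (2 * ‖m‖)
  have hsmall : ‖m (f - lpTruncation l f)‖ ≤ ‖m f‖ / 2 :=
    calc ‖m (f - lpTruncation l f)‖ ≤ ‖m‖ * l :=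
          m.le_opNorm_of_le (norm_sub_lpTruncation_le (by positivity) f)
      _ = ‖m‖ / ‖m‖ * (‖m f‖ / 2) := by ring
      _ ≤ ‖m f‖ / 2 := mul_le_of_le_one_left (by positivity) (div_self_le_one _)
  have htri : ‖m f‖ ≤ ‖m (f - lpTruncation l f)‖ + ‖m (lpTruncation l f)‖ := by
    rw [map_sub]
    exact norm_le_norm_sub_add _ _
  linarith

theorem norm_rpow_div_smul_rpow {l p : ℝ} (hp : p ≠ 0) (hl : 0 ≤ l) (s : ℝ) (x : F) :
    ‖((l ^ (s / p) : ℝ) : 𝕜) • x‖ ^ p = l ^ s * ‖x‖ ^ p := by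
  have hscale : 0 ≤ l ^ (s / p) := by positivity
  rw [norm_smul, RCLike.norm_ofReal, abs_of_nonneg hscale, Real.mul_rpow hscale (norm_nonneg x),
    ← Real.rpow_mul hl, div_mul_cancel₀ _ hp]

theorem exists_norm_rpow_le_and_norm_apply_rpow_le (m : lp E ∞ →L[𝕜] F) {p q : ℝ} (hp : 0 < p)
    (hpq : p ≤ q) (f : lp E ∞) :
    ∃ h : lp E ∞, (∀ i, ‖h i‖ ^ p ≤ ‖f i‖ ^ q) ∧
      ‖m f‖ ^ q ≤ 2 ^ q * ‖m‖ ^ (q - p) * ‖m h‖ ^ p := by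
  set l := ‖m f‖ / (2 * ‖m‖) with hl
  have hl0 : 0 ≤ l := by positivity
  refine ⟨((l ^ ((q - p) / p) : ℝ) : 𝕜) • lpTruncation l f, fun i => ?_, ?_⟩
  · rw [lp.coeFn_smul, Pi.smul_apply, norm_rpow_div_smul_rpow hp.ne' hl0]
    exact rpow_mul_norm_lpTruncation_rpow_le hl0 hp hpq f i
  · rw [map_smul, norm_rpow_div_smul_rpow hp.ne' hl0]
    rcases (norm_nonneg (m f)).eq_or_lt with h0 | h0
    · rw [← h0, Real.zero_rpow (hp.trans_le hpq).ne']
      positivity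
    have hm : 0 < ‖m‖ := norm_pos_iff.2 fun hm => by simp [hm] at h0
    calc ‖m f‖ ^ q = ‖m f‖ ^ (q - p) * ‖m f‖ ^ p := by rw [← Real.rpow_add h0, sub_add_cancel]
      _ = (2 * ‖m‖ * l) ^ (q - p) * (2 * (‖m f‖ / 2)) ^ p := by
          rw [hl]
          congr 2 <;> field_simp
      _ ≤ (2 * ‖m‖ * l) ^ (q - p) * (2 * ‖m (lpTruncation l f)‖) ^ p := by
          gcongr
          exact norm_half_le_norm_apply_lpTruncation m f
      _ = 2 ^ (q - p) * 2 ^ p * ‖m‖ ^ (q - p) *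
            (l ^ (q - p) * ‖m (lpTruncation l f)‖ ^ p) := by
          rw [Real.mul_rpow (by positivity) hl0, Real.mul_rpow zero_le_two hm.le,
            Real.mul_rpow zero_le_two (norm_nonneg _)]
          ring
      _ = _ := by rw [← Real.rpow_add zero_lt_two, sub_add_cancel]

end Truncation

namespace BanachLeftModule

variable {A : Type u} [NonUnitalNormedRing A] [NormedSpace ℂ A] [IsScalarTower ℂ A A]
  [SMulCommClass ℂ A A] [CompleteSpace A]
  {F : Type v} [NormedAddCommGroup F] [NormedSpace ℂ F] [CompleteSpace F]

/-- The coinduced module of a Banach space `J`: the bounded operators from `A` to `J`, with the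
action `(a · T) b = T (b a)`. -/
def coinduced (A : Type u) [NonUnitalNormedRing A] [NormedSpace ℂ A] [IsScalarTower ℂ A A]
    [SMulCommClass ℂ A A] [CompleteSpace A]
    (J : Type w) [NormedAddCommGroup J] [NormedSpace ℂ J] [CompleteSpace J] :
    BanachLeftModule A (A →L[ℂ] J) where
  act := (ContinuousLinearMap.compL ℂ A A J).flip ∘L (ContinuousLinearMap.mul ℂ A).flip
  mul_act a b T := by
    ext c
    simp [mul_assoc]

theorem coinduced_act_apply {J : Type w} [NormedAddCommGroup J] [NormedSpace ℂ J]
    [CompleteSpace J] (a b : A) (T : A →L[ℂ] J) : (coinduced A J).act a T b = T (b * a) := rfl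

/-- The morphism `y ↦ (a ↦ P (a · y))` into the coinduced module that corresponds to a bounded
operator `P`. -/
def coextend (mF : BanachLeftModule A F) {J : Type w} [NormedAddCommGroup J] [NormedSpace ℂ J]
    (P : F →L[ℂ] J) : F →L[ℂ] A →L[ℂ] J :=
  ContinuousLinearMap.compL ℂ A F J P ∘L mF.act.flip

theorem coextend_apply (mF : BanachLeftModule A F) {J : Type w} [NormedAddCommGroup J]
    [NormedSpace ℂ J] (P : F →L[ℂ] J) (y : F) (a : A) : mF.coextend P y a = P (mF.act a y) := rfl

theorem isMorphism_coextend (mF : BanachLeftModule A F) {J : Type w} [NormedAddCommGroup J]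
    [NormedSpace ℂ J] [CompleteSpace J] (P : F →L[ℂ] J) :
    IsMorphism mF (coinduced A J) (mF.coextend P) := fun a y => by
  ext b
  rw [coinduced_act_apply, coextend_apply, coextend_apply, mF.mul_act]

variable {J : Type u} [NormedAddCommGroup J] [NormedSpace ℂ J] [CompleteSpace J]
  {mJ : BanachLeftModule A J}

theorem IsInjective.exists_retraction (h : mJ.IsInjective) {e : A} (he : ∀ x, mJ.act e x = x) :
    ∃ R : (A →L[ℂ] J) →L[ℂ] J, IsMorphism (coinduced A J) mJ R ∧
      ∀ x, R (mJ.act.flip x) = x := by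
  have heval : ContinuousLinearMap.apply ℂ J e ∘L mJ.act.flip = .id ℂ J :=
    ContinuousLinearMap.ext he
  have hadm : IsAdmissibleMono mJ.act.flip :=
    ⟨Function.LeftInverse.injective (g := ContinuousLinearMap.apply ℂ J e) he, _, heval⟩
  obtain ⟨R, hR, hRid⟩ := h J (A →L[ℂ] J) mJ (coinduced A J) mJ.act.flip (.id ℂ J)
    (mJ.isMorphism_coextend (.id ℂ J)) hadm fun _ _ => rfl
  exact ⟨R, hR, DFunLike.congr_fun hRid⟩

theorem isInjective_of_retraction {R : (A →L[ℂ] J) →L[ℂ] J}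
    (hR : IsMorphism (coinduced A J) mJ R) (hRid : ∀ x, R (mJ.act.flip x) = x) :
    mJ.IsInjective := by
  rintro E F _ _ _ _ _ _ mE mF T S hT ⟨-, L, hLT⟩ hS
  refine ⟨R ∘L mF.coextend (S ∘L L), fun a y => ?_, ?_⟩
  · exact (congrArg R (mF.isMorphism_coextend (S ∘L L) a y)).trans (hR a _)
  · ext x
    have horbit : mF.coextend (S ∘L L) (T x) = mJ.act.flip (S x) := by
      ext a
      calc S (L (mF.act a (T x))) = S (L (T (mE.act a x))) := by rw [hT]
        _ = S (mE.act a x) := congrArg S (DFunLike.congr_fun hLT _)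
        _ = mJ.act a (S x) := hS a x
    exact (congrArg R horbit).trans (hRid (S x))

end BanachLeftModule

namespace Ell

section Basis

variable {G : Type u}

open scoped Classical in
/-- The point mass at `s`, as an element of `ℓ^p(G)`. -/
def delta (p : ℝ≥0∞) (s : G) : Ell G p := lp.single p s 1

theorem delta_apply_self (p : ℝ≥0∞) (s : G) : delta p s s = 1 := by
  classical
  simp [delta]

theorem norm_delta (p : ℝ≥0∞) [hp : Fact (1 ≤ p)] (s : G) : ‖delta p s‖ = 1 := by
  classical
  rw [delta, lp.norm_single (zero_lt_one.trans_le hp.out), norm_one]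

theorem norm_sum_smul_delta_rpow {p : ℝ≥0∞} (hp : 0 < p.toReal) {ι : Type*} (e : ι ↪ G)
    (U : Finset ι) (c : ι → ℂ) :
    ‖∑ u ∈ U, c u • delta p (e u)‖ ^ p.toReal = ∑ u ∈ U, ‖c u‖ ^ p.toReal := by
  classical
  have h := lp.norm_sum_single hp (Function.extend e c 0) (U.map e)
  simp only [Finset.sum_map, e.injective.extend_apply] at h
  rw [← h]
  congr! 4 with u
  rw [delta, ← lp.single_smul, smul_eq_mul, mul_one]

theorem hasSum_smul_delta (a : Ell G 1) : HasSum (fun t => a t • delta 1 t) a := by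
  classical
  convert! lp.hasSum_single ENNReal.one_ne_top a using 2 with t
  rw [delta, ← lp.single_smul, smul_eq_mul, mul_one]

variable {E : Type v} [NormedAddCommGroup E] [NormedSpace ℂ E]

theorem hasSum_smul_apply_delta (T : Ell G 1 →L[ℂ] E) (a : Ell G 1) :
    HasSum (fun t => a t • T (delta 1 t)) (T a) := by
  simpa only [map_smul] using (hasSum_smul_delta a).mapL T

theorem clm_ext {T S : Ell G 1 →L[ℂ] E} (h : ∀ t, T (delta 1 t) = S (delta 1 t)) : T = S := by
  ext a
  refine (hasSum_smul_apply_delta T a).unique ?_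
  simpa only [h] using hasSum_smul_apply_delta S a

theorem opNorm_le_of_norm_apply_delta_le {T : Ell G 1 →L[ℂ] E} {K : ℝ} (hK : 0 ≤ K)
    (h : ∀ t, ‖T (delta 1 t)‖ ≤ K) : ‖T‖ ≤ K := by
  refine T.opNorm_le_bound hK fun a => ?_
  have ha : HasSum (fun t => K * ‖a t‖) (K * ‖a‖) := by
    rw [norm_one_eq]
    exact (summable_norm_one a).hasSum.mul_left K
  refine (hasSum_smul_apply_delta T a).norm_le_of_bounded ha fun t => ?_
  rw [norm_smul, mul_comm]
  gcongr
  exact h t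

theorem norm_apply_delta_le (T : Ell G 1 →L[ℂ] E) (t : G) : ‖T (delta 1 t)‖ ≤ ‖T‖ := by
  simpa only [norm_delta, mul_one] using T.le_opNorm (delta 1 t)

end Basis

variable {G : Type u} [Group G]

section Translation

variable {p : ℝ≥0∞} [Fact (1 ≤ p)]

theorem delta_conv (s : G) (x : Ell G p) : conv (delta 1 s) x = translate s x := by
  classical
  rw [conv_eq_tsum, tsum_eq_single s, delta_apply_self, one_smul]
  intro t ht
  simp [delta, ht]

theorem translate_delta (s t : G) : translate s (delta p t) = delta p (s * t) := by
  classical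
  refine lp.ext (funext fun r => ?_)
  simp only [translate_apply, delta, lp.single_apply, Pi.single_apply, inv_mul_eq_iff_eq_mul]

theorem delta_mul_delta (s t : G) : delta 1 s * delta 1 t = delta 1 (s * t) :=
  (delta_conv s (delta 1 t)).trans (translate_delta s t)

theorem banachModule_act_delta_apply (s : G) (x : Ell G p) (t : G) :
    (banachModule G p).act (delta 1 s) x t = x (s⁻¹ * t) := by
  change conv (delta 1 s) x t = x (s⁻¹ * t)
  rw [delta_conv, translate_apply]

theorem banachModule_act_delta_one (x : Ell G p) : (banachModule G p).act (delta 1 1) x = x :=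
  lp.ext (funext fun t => by rw [banachModule_act_delta_apply, inv_one, one_mul])

theorem banachModule_act_delta_delta (s t : G) :
    (banachModule G p).act (delta 1 s) (delta p t) = delta p (s * t) :=
  (delta_conv s (delta p t)).trans (translate_delta s t)

theorem isMorphism_of_act_delta {E : Type v} [NormedAddCommGroup E] [NormedSpace ℂ E]
    [CompleteSpace E] {F : Type w} [NormedAddCommGroup F] [NormedSpace ℂ F] [CompleteSpace F]
    {mE : BanachLeftModule (Ell G 1) E} {mF : BanachLeftModule (Ell G 1) F} {T : E →L[ℂ] F}
    (h : ∀ s x, T (mE.act (delta 1 s) x) = mF.act (delta 1 s) (T x)) :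
    BanachLeftModule.IsMorphism mE mF T := fun a x =>
  DFunLike.congr_fun (clm_ext (T := T ∘L mE.act.flip x) (S := mF.act.flip (T x)) fun s => h s x) a

end Translation

/-- The upper `p`-estimate for a functional on `ℓ^∞(G)`, with constant `C`. In terms of the right
translates `t ↦ g u (t * u)`, it says that if these satisfy a pointwise `ℓ^p`-bound in `u`, then so
do the values `m (g u)`. -/
def HasUpperEstimate (m : Ell G ∞ →L[ℂ] ℂ) (p C : ℝ) : Prop :=
  ∀ (U : Finset G) (g : G → Ell G ∞) (K : ℝ),
    (∀ t, ∑ u ∈ U, ‖g u (t * u)‖ ^ p ≤ K) → ∑ u ∈ U, ‖m (g u)‖ ^ p ≤ C * K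

theorem HasUpperEstimate.nonneg {m : Ell G ∞ →L[ℂ] ℂ} {p C : ℝ} (h : HasUpperEstimate m p C) :
    0 ≤ C := by
  simpa using h ∅ 0 1 fun _ => by simp

theorem HasUpperEstimate.of_le {m : Ell G ∞ →L[ℂ] ℂ} {p q C : ℝ} (hp : 0 < p) (hpq : p ≤ q)
    (h : HasUpperEstimate m p C) : HasUpperEstimate m q (2 ^ q * ‖m‖ ^ (q - p) * C) := by
  intro U g K hg
  choose τ hτ hmτ using exists_norm_rpow_le_and_norm_apply_rpow_le m hp hpq
  calc ∑ u ∈ U, ‖m (g u)‖ ^ q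
      ≤ ∑ u ∈ U, 2 ^ q * ‖m‖ ^ (q - p) * ‖m (τ (g u))‖ ^ p := Finset.sum_le_sum fun u _ => hmτ (g u)
    _ = 2 ^ q * ‖m‖ ^ (q - p) * ∑ u ∈ U, ‖m (τ (g u))‖ ^ p := (Finset.mul_sum ..).symm
    _ ≤ 2 ^ q * ‖m‖ ^ (q - p) * (C * K) := by
        gcongr
        exact h U (fun u => τ (g u)) K fun t =>
          (Finset.sum_le_sum fun u _ => hτ (g u) (t * u)).trans (hg t)
    _ = 2 ^ q * ‖m‖ ^ (q - p) * C * K := by ring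

section RetractionToFunctional

open BanachLeftModule

variable {p : ℝ≥0∞} [Fact (1 ≤ p)]

/-- The diagonal operator `ℓ¹(G) → ℓ^p(G)` of a bounded function `g`, which is `a ↦ (g a) ⋆ δ_1`:
convolution with `δ_1` serves as the inclusion of `ℓ¹(G)` in `ℓ^p(G)`. -/
def diagonalOp (G : Type u) [Group G] (p : ℝ≥0∞) [Fact (1 ≤ p)] :
    Ell G ∞ →L[ℂ] Ell G 1 →L[ℂ] Ell G p :=
  ContinuousLinearMap.compL ℂ (Ell G 1) (Ell G 1) (Ell G p)
      ((banachModule G p).act.flip (delta p 1)) ∘L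
    lp.holderL (K := 1) 1 (fun _ : G => ContinuousLinearMap.mul ℂ ℂ) fun _ => by simp

theorem diagonalOp_delta (g : Ell G ∞) (t : G) :
    diagonalOp G p g (delta 1 t) = g t • delta p t := by
  have hmul : lp.holderL (K := 1) 1 (fun _ : G => ContinuousLinearMap.mul ℂ ℂ)
      (fun _ => by simp) g (delta 1 t) = g t • delta 1 t := by
    refine lp.ext (funext fun s => ?_)
    change g s * delta 1 t s = g t * delta 1 t s
    rcases eq_or_ne s t with rfl | hst
    · rfl
    · simp [delta, hst]
  calc diagonalOp G p g (delta 1 t)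
      = (banachModule G p).act.flip (delta p 1) (g t • delta 1 t) :=
        congrArg ((banachModule G p).act.flip (delta p 1)) hmul
    _ = g t • delta p t := by
        rw [map_smul, ContinuousLinearMap.flip_apply, banachModule_act_delta_delta, mul_one]

theorem diagonalOp_one : diagonalOp G p 1 = (banachModule G p).act.flip (delta p 1) :=
  clm_ext fun t => by
    rw [diagonalOp_delta, ContinuousLinearMap.flip_apply, banachModule_act_delta_delta, mul_one,
      lp.infty_coeFn_one, Pi.one_apply, one_smul]

theorem norm_sum_act_diagonalOp_rpow_le (hp : p ≠ ∞) {U : Finset G} {g : G → Ell G ∞} {K : ℝ}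
    (hg : ∀ t, ∑ u ∈ U, ‖g u (t * u)‖ ^ p.toReal ≤ K) :
    ‖∑ u ∈ U, (coinduced (Ell G 1) (Ell G p)).act (delta 1 u) (diagonalOp G p (g u))‖ ^ p.toReal
      ≤ K := by
  have hp0 : 0 < p.toReal := zero_lt_one.trans_le (p.dichotomy.resolve_left hp)
  have hK : 0 ≤ K := (Finset.sum_nonneg fun _ _ => by positivity).trans (hg 1)
  rw [← Real.le_rpow_inv_iff_of_pos (norm_nonneg _) hK hp0]
  refine opNorm_le_of_norm_apply_delta_le (by positivity) fun t => ?_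
  rw [Real.le_rpow_inv_iff_of_pos (norm_nonneg _) hK hp0]
  refine le_of_eq_of_le ?_ (hg t)
  simp only [sum_apply, coinduced_act_apply, delta_mul_delta, diagonalOp_delta]
  exact norm_sum_smul_delta_rpow hp0 (mulLeftEmbedding t) U fun u => g u (t * u)

theorem hasUpperEstimate_of_isMorphism (hp : p ≠ ∞)
    {R : (Ell G 1 →L[ℂ] Ell G p) →L[ℂ] Ell G p}
    (hR : IsMorphism (coinduced (Ell G 1) (Ell G p)) (banachModule G p) R) :
    HasUpperEstimate (lp.evalCLM ℂ (fun _ : G => ℂ) p 1 ∘L R ∘L diagonalOp G p) p.toReal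
      (‖R‖ ^ p.toReal) := by
  intro U g K hg
  have hp1 : 1 ≤ p.toReal := p.dichotomy.resolve_left hp
  have hsigns (ε : G → ℤˣ) : ∑ v ∈ U, ‖∑ u ∈ U, ε u • R (diagonalOp G p (g u)) (u⁻¹ * v)‖ ^ p.toReal
      ≤ ‖R‖ ^ p.toReal * K := by
    let Y : Ell G 1 →L[ℂ] Ell G p :=
      ∑ u ∈ U, (coinduced (Ell G 1) (Ell G p)).act (delta 1 u) (diagonalOp G p (ε u • g u))
    have hY : ‖Y‖ ^ p.toReal ≤ K := norm_sum_act_diagonalOp_rpow_le hp fun t => by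
      refine le_of_eq_of_le (Finset.sum_congr rfl fun u _ => ?_) (hg t)
      rw [← norm_units_zsmul (ε u) (g u (t * u))]
      rfl
    have hRY (v : G) : R Y v = ∑ u ∈ U, ε u • R (diagonalOp G p (g u)) (u⁻¹ * v) := by
      simp only [Y, map_sum, hR _ _, lp.coeFn_sum, Finset.sum_apply, Units.smul_def, map_zsmul]
      refine Finset.sum_congr rfl fun u _ => ?_
      rw [← banachModule_act_delta_apply]
      rfl
    calc ∑ v ∈ U, ‖∑ u ∈ U, ε u • R (diagonalOp G p (g u)) (u⁻¹ * v)‖ ^ p.toReal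
        = ∑ v ∈ U, ‖R Y v‖ ^ p.toReal := by simp only [hRY]
      _ ≤ ‖R Y‖ ^ p.toReal := lp.sum_rpow_le_norm_rpow (zero_lt_one.trans_le hp1) (R Y) U
      _ ≤ (‖R‖ * ‖Y‖) ^ p.toReal := by gcongr; exact R.le_opNorm Y
      _ = ‖R‖ ^ p.toReal * ‖Y‖ ^ p.toReal := Real.mul_rpow (norm_nonneg R) (norm_nonneg Y)
      _ ≤ ‖R‖ ^ p.toReal * K := by gcongr
  have hdiag := sum_norm_diag_rpow_le_of_forall_signs hp1 U _ hsigns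
  simp only [inv_mul_cancel] at hdiag
  exact hdiag

end RetractionToFunctional

section FunctionalToRetraction

open BanachLeftModule

variable {p : ℝ≥0∞} [Fact (1 ≤ p)]

/-- The generalized diagonal `t ↦ T (δ_{t u⁻¹}) t` of an operator `T : ℓ¹(G) → ℓ^p(G)`. -/
def diagonal (u : G) : (Ell G 1 →L[ℂ] Ell G p) →ₗ[ℂ] Ell G ∞ where
  toFun T := ⟨fun t => T (delta 1 (t * u⁻¹)) t, memℓp_infty ⟨‖T‖, by
    rintro _ ⟨t, rfl⟩
    exact (lp.norm_apply_le_norm (zero_lt_one.trans_le Fact.out).ne' _ t).trans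
      (norm_apply_delta_le T _)⟩⟩
  map_add' _ _ := rfl
  map_smul' _ _ := rfl

theorem diagonal_apply (u : G) (T : Ell G 1 →L[ℂ] Ell G p) (t : G) :
    diagonal u T t = T (delta 1 (t * u⁻¹)) t := rfl

theorem diagonal_coinduced_act_delta (s u : G) (T : Ell G 1 →L[ℂ] Ell G p) :
    diagonal u ((coinduced (Ell G 1) (Ell G p)).act (delta 1 s) T) = diagonal (s⁻¹ * u) T :=
  lp.ext (funext fun t => by
    rw [diagonal_apply, diagonal_apply, coinduced_act_apply, delta_mul_delta, mul_inv_rev, inv_inv,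
      mul_assoc])

theorem diagonal_act_flip (u : G) (x : Ell G p) :
    diagonal u ((banachModule G p).act.flip x) = x u • (1 : Ell G ∞) :=
  lp.ext (funext fun t => by
    rw [diagonal_apply, ContinuousLinearMap.flip_apply, banachModule_act_delta_apply, mul_inv_rev,
      inv_inv, inv_mul_cancel_right, lp.coeFn_smul, Pi.smul_apply, lp.infty_coeFn_one,
      Pi.one_apply, smul_eq_mul, mul_one])

variable {m : Ell G ∞ →L[ℂ] ℂ} {C : ℝ}

theorem HasUpperEstimate.sum_norm_apply_diagonal_rpow_le (hm : HasUpperEstimate m p.toReal C)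
    (hp : p ≠ ∞) (T : Ell G 1 →L[ℂ] Ell G p) (U : Finset G) :
    ∑ u ∈ U, ‖m (diagonal u T)‖ ^ p.toReal ≤ C * ‖T‖ ^ p.toReal := by
  have hp0 : 0 < p.toReal := zero_lt_one.trans_le (p.dichotomy.resolve_left hp)
  refine hm U (diagonal · T) _ fun t => ?_
  calc ∑ u ∈ U, ‖diagonal u T (t * u)‖ ^ p.toReal
      = ∑ s ∈ U.map (mulLeftEmbedding t), ‖T (delta 1 t) s‖ ^ p.toReal := by
        simp only [diagonal_apply, mul_inv_cancel_right, Finset.sum_map, mulLeftEmbedding_apply]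
    _ ≤ ‖T (delta 1 t)‖ ^ p.toReal := lp.sum_rpow_le_norm_rpow hp0 _ _
    _ ≤ ‖T‖ ^ p.toReal := by gcongr; exact norm_apply_delta_le T t

/-- The operator `T ↦ (u ↦ m (diagonal u T))`, which averages the generalized diagonals of `T` by a
functional with an upper `p`-estimate. -/
def HasUpperEstimate.averaging (hm : HasUpperEstimate m p.toReal C) (hp : p ≠ ∞) :
    (Ell G 1 →L[ℂ] Ell G p) →L[ℂ] Ell G p :=
  LinearMap.mkContinuous
    { toFun T := ⟨fun u => m (diagonal u T),
        memℓp_gen' (hm.sum_norm_apply_diagonal_rpow_le hp T)⟩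
      map_add' T S := lp.ext (funext fun u => by
        change m (diagonal u (T + S)) = m (diagonal u T) + m (diagonal u S)
        rw [map_add, map_add])
      map_smul' c T := lp.ext (funext fun u => by
        change m (diagonal u (c • T)) = c • m (diagonal u T)
        rw [map_smul, map_smul]) }
    (C ^ p.toReal⁻¹) fun T => by
      have hp0 : 0 < p.toReal := zero_lt_one.trans_le (p.dichotomy.resolve_left hp)
      have hC := hm.nonneg
      refine lp.norm_le_of_forall_sum_le hp0 (by positivity) fun U => ?_
      rw [Real.mul_rpow (by positivity) (norm_nonneg T), Real.rpow_inv_rpow hC hp0.ne']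
      exact hm.sum_norm_apply_diagonal_rpow_le hp T U

theorem HasUpperEstimate.averaging_apply (hm : HasUpperEstimate m p.toReal C) (hp : p ≠ ∞)
    (T : Ell G 1 →L[ℂ] Ell G p) (u : G) : hm.averaging hp T u = m (diagonal u T) := rfl

theorem HasUpperEstimate.isMorphism_averaging (hm : HasUpperEstimate m p.toReal C) (hp : p ≠ ∞) :
    IsMorphism (coinduced (Ell G 1) (Ell G p)) (banachModule G p) (hm.averaging hp) :=
  isMorphism_of_act_delta fun s T => lp.ext (funext fun u => by
    rw [banachModule_act_delta_apply, hm.averaging_apply, hm.averaging_apply,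
      diagonal_coinduced_act_delta])

theorem HasUpperEstimate.averaging_act_flip (hm : HasUpperEstimate m p.toReal C) (hp : p ≠ ∞)
    (hm1 : m 1 = 1) (x : Ell G p) : hm.averaging hp ((banachModule G p).act.flip x) = x :=
  lp.ext (funext fun u => by
    rw [hm.averaging_apply, diagonal_act_flip, map_smul, hm1, smul_eq_mul, mul_one])

end FunctionalToRetraction

theorem isInjective_banachModule_iff {p : ℝ≥0∞} [Fact (1 ≤ p)] (hp : p ≠ ∞) :
    (banachModule G p).IsInjective ↔
      ∃ (m : Ell G ∞ →L[ℂ] ℂ) (C : ℝ), m 1 = 1 ∧ HasUpperEstimate m p.toReal C := by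
  constructor
  · intro h
    obtain ⟨R, hR, hRid⟩ := h.exists_retraction banachModule_act_delta_one
    refine ⟨_, _, ?_, hasUpperEstimate_of_isMorphism hp hR⟩
    change R (diagonalOp G p 1) 1 = 1
    rw [diagonalOp_one, hRid, delta_apply_self]
  · rintro ⟨m, C, hm1, hm⟩
    exact BanachLeftModule.isInjective_of_retraction (hm.isMorphism_averaging hp)
      (hm.averaging_act_flip hp hm1)

end Ell

end

theorem mainTheorem6_general (G : Type u) [Group G] (p q : ℝ≥0∞) [Fact (1 ≤ p)] [Fact (1 ≤ q)]
    (hpq : p ≤ q) (hq : q < ∞) (h : (Ell.banachModule G p).IsInjective) :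
    (Ell.banachModule G q).IsInjective := by
  have hp : p ≠ ∞ := (hpq.trans_lt hq).ne
  have hp0 : 0 < p.toReal := zero_lt_one.trans_le (p.dichotomy.resolve_left hp)
  obtain ⟨m, C, hm1, hm⟩ := (Ell.isInjective_banachModule_iff hp).1 h
  exact (Ell.isInjective_banachModule_iff hq.ne).2
    ⟨m, _, hm1, hm.of_le hp0 (ENNReal.toReal_mono hq.ne hpq)⟩

theorem mainTheorem6 (G : Type u) [Group G] (p q : ℝ≥0∞) [Fact (1 ≤ p)] [Fact (1 ≤ q)]
    (hp : 1 < p) (hpq : p ≤ q) (hq : q < ∞)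
    (h : (Ell.banachModule G p).IsInjective) :
    (Ell.banachModule G q).IsInjective :=
  mainTheorem6_general G p q hpq hq h
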